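/- **Theorem.** Let $S$ be a Polish space, with $\wp(S)$ the set of its Borel probability measures. For a lower semicontinuous function $V:S\times S\to[0,\infty)$ let $\mathcal P_V(S)$ be the set of $\mu\in\wp(S)$ with $\int V(s,s_0)\,\mu(ds)<\infty$ for some $s_0\in S$, and for $\mu_1,\mu_2\in\wp(S)$ let $$W_V(\mu_1,\mu_2)=\inf_{\xi}\int_{S\times S} V\,d\xi\in[0,\infty],$$ the infimum being over all probability measures $\xi$ on $S\times S$ with marginals $\mu_1$ and $\mu_2$. Call $V$ a *divergence function* if moreover (i) $V(x,y)=0$ if and only if $x=y$; (ii) $V(x,y)=V(y,x)$; (iii) for every $q\ge 0$ and every compact $K\subset S$ there is a compact $L\subset S$ with $V(x,y)\ge q$ for all $x\notin L$, $y\in K$. Let $(\Omega,\mathcal F,\mathbb P)$ be a probability space, $\mathcal G_0,\mathcal G_1,\mathcal G_2,\dots\subset\mathcal F$ independent $\sigma$-algebras, $s_0:\Omega\to S$ a $\mathcal G_0$-measurable initial state, and $\hat T_k:\Omega\times S\to S$ ($k\ge 0$) random operators, $\hat T_k$ being jointly measurable with respect to $\mathcal G_{k+1}\otimes\mathcal B(S)$.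 Assume that all of them have the same one-step transition kernel $\mathfrak Q(x,B)=\mathbb P(\hat T_k(x)\in B)$, and let $s_{k+1}=\hat T_k(s_k)$ for $k\ge 0$. For $\mu\in\wp(S)$ write $\mu\mathfrak Q(B)=\int\mathfrak Q(s,B)\,\mu(ds)$, and let $\mathfrak Q^k$ be the $k$-step kernel. Let $s^*\in S$, and let $\delta_{s^*}$ be the unit mass at $s^*$. Suppose that: 1. there are a divergence function $\tilde V$ and $\tilde\alpha\in(0,1)$ such that $W_{\tilde V}(\mu_1\mathfrak Q,\mu_2\mathfrak Q)\le\tilde\alpha\,W_{\tilde V}(\mu_1,\mu_2)$ for all $\mu_1,\mu_2\in\mathcal P_{\tilde V}(S)$, and there is a nonempty set $\mathcal M\subset\mathcal P_{\tilde V}(S)$ such that $\sup_{k\ge0}W_{\tilde V}(\mu\mathfrak Q^k,\mu)<\infty$ for every $\mu\in\mathcal M$; 2. there are a lower semicontinuous $V:S\times S\to[0,\infty)$, $\alpha\in(0,1)$ and $\epsilon>0$ such that $W_V(\mu\mathfrak Q,\delta_{s^*})\le\alpha W_V(\mu,\delta_{s^*})+\epsilon$ for all $\mu\in\mathcal P_V(S)$.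 Then there is exactly one probability measure $\vartheta$ on $S$ with $\vartheta\mathfrak Q=\vartheta$, and $$W_V(\vartheta,\delta_{s^*})\le\frac{\epsilon}{1-\alpha}.$$ Moreover, for every $\kappa>0$, $$\limsup_{k\to\infty}\mathbb P\big(V(s_k,s^*)\ge\kappa\big)\le\frac{\epsilon}{\kappa(1-\alpha)},$$ and the limit exists, and equals $\vartheta(\{x: V(x,s^*)\ge\kappa\})$, whenever the topological boundary of $\{x:V(x,s^*)\ge\kappa\}$ is a $\vartheta$-null set. -/

import Mathlib

open MeasureTheory ProbabilityTheory Filter Topology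
open scoped NNReal ENNReal

namespace WassersteinDivergence

/-- A divergence function on `S`: a lower semicontinuous, positive definite, symmetric and
inf-compact function `V : S × S → [0, ∞)`. -/
structure IsDivergence {S : Type*} [TopologicalSpace S] (V : S × S → ℝ≥0) : Prop where
  lowerSemicontinuous : LowerSemicontinuous V
  pos_def : ∀ x y : S, V (x, y) = 0 ↔ x = y
  symm : ∀ x y : S, V (x, y) = V (y, x)
  inf_compact : ∀ (q : ℝ≥0) (K : Set S), IsCompact K →
    ∃ L : Set S, IsCompact L ∧ ∀ x ∈ Lᶜ, ∀ y ∈ K, q ≤ V (x, y)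

/-- The couplings of `μ` and `ν`: probability measures on `S × S` with marginals `μ` and `ν`. -/
def couplings {S : Type*} [MeasurableSpace S] (μ ν : Measure S) : Set (Measure (S × S)) :=
  {ξ | IsProbabilityMeasure ξ ∧ ξ.map Prod.fst = μ ∧ ξ.map Prod.snd = ν}

/-- The Wasserstein divergence: the infimum of `∫ V dξ` over the couplings `ξ` of `μ` and `ν`,
with values in `[0, ∞]`. -/
noncomputable def wassersteinDiv {S : Type*} [MeasurableSpace S] (V : S × S → ℝ≥0)
    (μ ν : Measure S) : ℝ≥0∞ :=
  ⨅ ξ ∈ couplings μ ν, ∫⁻ p, (V p : ℝ≥0∞) ∂ξ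

/-- The probability measures `μ` on `S` with `∫ V(s, s₀) μ(ds) < ∞` for some `s₀`. -/
def finiteMoment {S : Type*} [MeasurableSpace S] (V : S × S → ℝ≥0) : Set (Measure S) :=
  {μ | IsProbabilityMeasure μ ∧ ∃ s₀ : S, ∫⁻ x, (V (x, s₀) : ℝ≥0∞) ∂μ < ∞}

/-- The contraction assumption on the transition kernel `Q` for the divergence function `V`.
Here `μ.bind Q` is the measure `μQ` given by `(μQ)(B) = ∫ Q(s, B) μ(ds)`, and `Q ^ k` is the
`k`-step transition kernel. -/
structure ContractionAssumption {S : Type*} [TopologicalSpace S] [MeasurableSpace S]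
    (V : S × S → ℝ≥0) (Q : Kernel S S) : Prop where
  isDivergence : IsDivergence V
  contraction : ∃ α : ℝ, 0 < α ∧ α < 1 ∧ ∀ μ₁ ∈ finiteMoment V, ∀ μ₂ ∈ finiteMoment V,
    wassersteinDiv V (μ₁.bind Q) (μ₂.bind Q) ≤ ENNReal.ofReal α * wassersteinDiv V μ₁ μ₂
  bounded : ∃ M : Set (Measure S), M.Nonempty ∧ M ⊆ finiteMoment V ∧
    ∀ μ ∈ M, ∃ c : ℝ≥0, ⨆ k : ℕ, wassersteinDiv V (μ.bind (Q ^ k : Kernel S S)) μ ≤ (c : ℝ≥0∞)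

/-- `s` is produced by the iteration `s (k + 1) = T k (s k)` of the independent random operators
`T k : Ω → S → S` with common one-step transition kernel `Q`. The operator `T k` is a jointly
measurable function of the outcome and the state with respect to a sub-σ-algebra `𝒢 (k + 1)`,
the initial state is measurable with respect to `𝒢 0`, and the σ-algebras `𝒢 0, 𝒢 1, …` are
independent. -/
structure IsRandomOperatorIteration {Ω S : Type*} [mΩ : MeasurableSpace Ω] [mS : MeasurableSpace S]
    (P : Measure Ω) (T : ℕ → Ω → S → S) (s : ℕ → Ω → S) (Q : Kernel S S) : Prop where
  independent : ∃ 𝒢 : ℕ → MeasurableSpace Ω,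
    (∀ k, 𝒢 k ≤ mΩ) ∧ iIndep 𝒢 P ∧
    Measurable[𝒢 0] (s 0) ∧
    ∀ k, Measurable[(𝒢 (k + 1)).prod mS]
      (fun p : Ω × S => T k p.1 p.2)
  iterate : ∀ k ω, s (k + 1) ω = T k ω (s k ω)
  transition : ∀ k x, P.map (fun ω => T k ω x) = Q x

end WassersteinDivergence

/-! The cost $\tilde V$ obeys no triangle inequality, so a Banach fixed point argument is replaced
by weak convergence. The contraction is assumed only on $\mathcal P_{\tilde V}(S)$, but it extends
to all pairs of measures. By the strong law of large numbers a coupling of finite cost is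
approximated by empirical measures; their marginals have finite support, hence finite moments, and
lower semicontinuity of $W$ passes the bound to the limit (`wassersteinDiv_map_bind_le`).

For $\mu\in\mathcal M$ one gets $W(\mu\mathfrak Q^{n+k},\mu\mathfrak Q^n)\le\tilde\alpha^n c$.
Inf-compactness makes the orbit tight, and a cluster point $\vartheta$ satisfies
$W(\vartheta,\mu\mathfrak Q^n)\le\tilde\alpha^n c$. Since small $W$ forces weak closeness
(`IsDivergence.exists_measure_le_thickening`), the orbit converges to $\vartheta$ and also to
$\vartheta\mathfrak Q$, so $\vartheta$ is invariant.

For an arbitrary initial law $\rho$, the chains from $x$ and $y$ satisfy $W(\delta_x\mathfrak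
Q^k,\delta_y\mathfrak Q^k)\le\tilde\alpha^k\tilde V(x,y)$. Integrating the resulting comparison over
$\rho\otimes\vartheta$, with the error capped at 1, gives $\rho\mathfrak Q^k\to\vartheta$
(`tendsto_bind_pow`), hence uniqueness and the limit statement.

The quantitative bounds use the second assumption on Dirac masses only: it becomes a drift
inequality for $g=V(\cdot,s^*)$, which is iterated pointwise and integrated after truncation. -/

namespace WassersteinDivergence

/-! ### Empirical measures and the strong law of large numbers -/

section Empirical

variable {E : Type*} [MeasurableSpace E]

/-- The empirical measure of the first `n + 1` terms of a sequence. -/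
noncomputable def empiricalMeasure (x : ℕ → E) (n : ℕ) : Measure E :=
  ((n : ℝ≥0∞) + 1)⁻¹ • ∑ j ∈ Finset.range (n + 1), Measure.dirac (x j)

theorem lintegral_empiricalMeasure (x : ℕ → E) (n : ℕ) {h : E → ℝ≥0∞} (hh : Measurable h) :
    ∫⁻ p, h p ∂(empiricalMeasure x n) =
      ((n : ℝ≥0∞) + 1)⁻¹ * ∑ j ∈ Finset.range (n + 1), h (x j) := by
  simp [empiricalMeasure, lintegral_smul_measure, lintegral_finsetSum_measure,
    lintegral_dirac' _ hh]

instance (x : ℕ → E) (n : ℕ) : IsProbabilityMeasure (empiricalMeasure x n) := by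
  constructor
  have h : ((n : ℝ≥0∞) + 1) ≠ ∞ := by finiteness
  simp [empiricalMeasure, ENNReal.inv_mul_cancel (by simp) h]

theorem lintegral_empiricalMeasure_lt_top (x : ℕ → E) (n : ℕ) {h : E → ℝ≥0}
    (hh : Measurable h) : ∫⁻ p, (h p : ℝ≥0∞) ∂(empiricalMeasure x n) < ∞ := by
  rw [lintegral_empiricalMeasure x n hh.coe_nnreal_ennreal]
  have : ((n : ℝ≥0∞) + 1) ≠ 0 := by simp
  exact ENNReal.mul_lt_top (by simp) (by simp [ENNReal.sum_lt_top])

/-- A consequence of the strong law of large numbers: some sequence has empirical averages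
converging to the integral for each of countably many integrable functions. -/
theorem exists_tendsto_lintegral_empiricalMeasure {ι : Type*} [Countable ι]
    (ξ : Measure E) [IsProbabilityMeasure ξ] (h : ι → E → ℝ≥0) (hm : ∀ i, Measurable (h i))
    (hfin : ∀ i, ∫⁻ p, (h i p : ℝ≥0∞) ∂ξ < ∞) :
    ∃ x : ℕ → E, ∀ i, Tendsto (fun n => ∫⁻ p, (h i p : ℝ≥0∞) ∂(empiricalMeasure x n)) atTop
      (𝓝 (∫⁻ p, (h i p : ℝ≥0∞) ∂ξ)) := by
  let P := Measure.infinitePi (fun _ : ℕ => ξ)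
  have hmp (j : ℕ) : MeasurePreserving (fun ω : ℕ → E => ω j) P ξ :=
    measurePreserving_eval_infinitePi _ _
  have hr (i : ι) : Measurable (fun p => (h i p : ℝ)) := (hm i).coe_nnreal_real
  have hint (i : ι) : Integrable (fun p => (h i p : ℝ)) ξ := by
    refine ⟨(hr i).aestronglyMeasurable, ?_⟩
    simpa [HasFiniteIntegral, enorm_eq_nnnorm] using hfin i
  have key (i : ι) : ∀ᵐ ω ∂P, Tendsto
      (fun n : ℕ => (∑ j ∈ Finset.range n, (h i (ω j) : ℝ)) / n) atTop
      (𝓝 (∫ p, (h i p : ℝ) ∂ξ)) := by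
    have := strong_law_ae_real (μ := P) (fun j ω => (h i (ω j) : ℝ))
      ((hmp 0).integrable_comp_of_integrable (hint i))
      (fun j k hjk =>
        (iIndepFun_infinitePi (P := fun _ : ℕ => ξ) (X := fun _ p => (h i p : ℝ))
          (fun _ => hr i)).indepFun hjk)
      (fun j => ⟨((hr i).comp (hmp j).measurable).aemeasurable,
        ((hr i).comp (hmp 0).measurable).aemeasurable, by
          change P.map ((fun p => (h i p : ℝ)) ∘ fun ω : ℕ → E => ω j) =
            P.map ((fun p => (h i p : ℝ)) ∘ fun ω : ℕ → E => ω 0)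
          rw [← Measure.map_map (hr i) (hmp j).measurable,
            ← Measure.map_map (hr i) (hmp 0).measurable, (hmp j).map_eq, (hmp 0).map_eq]⟩)
    have heq : ∫ ω, (h i (ω 0) : ℝ) ∂P = ∫ p, (h i p : ℝ) ∂ξ := by
      rw [← (hmp 0).map_eq, integral_map (hmp 0).measurable.aemeasurable
        (hr i).aestronglyMeasurable]
    rwa [heq] at this
  obtain ⟨x, hx⟩ := (ae_all_iff.2 key).exists
  refine ⟨x, fun i => ?_⟩
  -- The shift by one matches the `n + 1` terms of the empirical measure.
  have h1 := ENNReal.tendsto_ofReal ((hx i).comp (tendsto_add_atTop_nat 1))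
  rw [ofReal_integral_eq_lintegral_ofReal (hint i) (ae_of_all _ fun p => by positivity)] at h1
  simp only [ENNReal.ofReal_coe_nnreal] at h1
  refine h1.congr fun n => ?_
  rw [lintegral_empiricalMeasure x n (hm i).coe_nnreal_ennreal, Function.comp_apply,
    ENNReal.ofReal_div_of_pos (by positivity), ENNReal.ofReal_sum_of_nonneg (by simp),
    div_eq_mul_inv, mul_comm]
  simp only [ENNReal.ofReal_coe_nnreal]
  congr 2
  norm_cast

end Empirical

/-! ### Criteria for weak convergence -/

section Weak

variable {E : Type*} [MeasurableSpace E] [TopologicalSpace E]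

/-- In a second countable space, countably many open sets determine weak convergence. -/
theorem exists_countable_isOpen_le_liminf [SecondCountableTopology E] :
    ∃ 𝒰 : Set (Set E), 𝒰.Countable ∧ (∀ U ∈ 𝒰, IsOpen U) ∧
      ∀ (μs : ℕ → Measure E) (μ : Measure E),
        (∀ U ∈ 𝒰, Tendsto (fun n => μs n U) atTop (𝓝 (μ U))) →
        ∀ G, IsOpen G → μ G ≤ liminf (fun n => μs n G) atTop := by
  let B : Set (Set E) := TopologicalSpace.countableBasis E
  have hB := TopologicalSpace.isBasis_countableBasis E
  have : Countable B := (TopologicalSpace.countable_countableBasis E).to_subtype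
  -- Finite unions of basic sets are countably many, and every open set is a directed union of them,
  -- so continuity from below applies.
  refine ⟨Set.range fun t : Finset B => ⋃ b ∈ t, (b : Set E), Set.countable_range _,
    Set.forall_mem_range.2 fun t => isOpen_biUnion fun b _ => hB.isOpen b.2,
    fun μs μ h G hG => ?_⟩
  refine le_of_forall_lt fun b hb => ?_
  let C : Set B := {b | (b : Set E) ⊆ G}
  have hC : (⋃ t : Finset C, ⋃ b ∈ t, ((b : B) : Set E)) = G := by
    apply Set.Subset.antisymm
    · exact Set.iUnion_subset fun t => Set.iUnion₂_subset fun b _ => b.2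
    · intro x hx
      obtain ⟨u, hu, hxu, huG⟩ := hB.exists_subset_of_mem_open hx hG
      exact Set.mem_iUnion.2 ⟨{⟨⟨u, hu⟩, huG⟩}, by simpa using hxu⟩
  have hdir : Directed (· ⊆ ·) fun t : Finset C => ⋃ b ∈ t, ((b : B) : Set E) := by
    classical
    refine directed_of_isDirected_le fun s t hst => ?_
    exact Set.biUnion_subset_biUnion_left hst
  rw [← hC, hdir.measure_iUnion] at hb
  obtain ⟨t, ht⟩ := lt_iSup_iff.1 hb
  have hset : (⋃ b ∈ t, ((b : B) : Set E)) =
      ⋃ b ∈ t.map (Function.Embedding.subtype _), (b : Set E) := by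
    ext x; simp
  rw [hset] at ht
  refine ht.trans_le ?_
  rw [← (h _ ⟨_, rfl⟩).liminf_eq]
  refine liminf_le_liminf (Eventually.of_forall fun n => measure_mono ?_)
  exact hset.symm.subset.trans (Set.iUnion₂_subset fun b _ => b.2)

/-- The layer-cake formula reduces the claim to the sets $\{V>t\}$, which are open by lower
semicontinuity; Fatou's lemma in $t$ does the rest. No bound on $V$ is needed. -/
theorem lintegral_le_liminf_lintegral_of_lowerSemicontinuous [OpensMeasurableSpace E]
    {μ : Measure E} {μs : ℕ → Measure E} {V : E → ℝ≥0} (hV : LowerSemicontinuous V)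
    (h : ∀ G, IsOpen G → μ G ≤ liminf (fun n => μs n G) atTop) :
    ∫⁻ x, (V x : ℝ≥0∞) ∂μ ≤ liminf (fun n => ∫⁻ x, (V x : ℝ≥0∞) ∂(μs n)) atTop := by
  have layer (m : Measure E) : ∫⁻ x, (V x : ℝ≥0∞) ∂m =
      ∫⁻ t : ℝ in Set.Ioi 0, m {x | t < (V x : ℝ)} := by
    rw [← lintegral_eq_lintegral_meas_lt _ (ae_of_all _ fun x => by positivity)
      hV.measurable.coe_nnreal_real.aemeasurable]
    simp
  simp_rw [layer]
  calc ∫⁻ t : ℝ in Set.Ioi 0, μ {x | t < (V x : ℝ)}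
      ≤ ∫⁻ t : ℝ in Set.Ioi 0, liminf (fun n => μs n {x | t < (V x : ℝ)}) atTop := by
        refine setLIntegral_mono' measurableSet_Ioi fun t ht => h _ ?_
        lift t to ℝ≥0 using (le_of_lt ht)
        simpa using! hV.isOpen_preimage t
    _ ≤ _ := lintegral_liminf_le fun n => Antitone.measurable fun s t hst =>
        measure_mono fun x hx => lt_of_le_of_lt hst hx

/-- If, for every compact `K` and `δ > 0`, the inequality `ρ k F ≤ ϑ (F^δ) + ϑ Kᶜ + o(1)` holds
for all closed sets `F`, then `ρ k` converges weakly to `ϑ`. -/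
theorem tendsto_of_le_measure_thickening {S : Type*} [MetricSpace S] [CompleteSpace S]
    [SecondCountableTopology S] [MeasurableSpace S] [BorelSpace S]
    {ρ : ℕ → ProbabilityMeasure S} {ϑ : ProbabilityMeasure S}
    (h : ∀ K : Set S, IsCompact K → ∀ δ : ℝ, 0 < δ → ∃ e : ℕ → ℝ≥0∞, Tendsto e atTop (𝓝 0) ∧
      ∀ k, ∀ F : Set S, IsClosed F → (ρ k : Measure S) F ≤
        (ϑ : Measure S) (Metric.thickening δ F) + (ϑ : Measure S) Kᶜ + e k) :
    Tendsto ρ atTop (𝓝 ϑ) := by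
  refine tendsto_of_forall_isClosed_limsup_le' fun F hF => ?_
  refine ENNReal.le_of_forall_pos_le_add fun η hη _ => ?_
  obtain ⟨K, hK, hϑK⟩ := isTightMeasureSet_iff_exists_isCompact_measure_compl_le.1
    (isTightMeasureSet_singleton (μ := (ϑ : Measure S))) η (by exact_mod_cast hη)
  have hle (δ : ℝ) (hδ : 0 < δ) : limsup (fun k => (ρ k : Measure S) F) atTop ≤
      (ϑ : Measure S) (Metric.thickening δ F) + η := by
    obtain ⟨e, he, hρ⟩ := h K hK δ hδ
    have hlim : Tendsto (fun k => (ϑ : Measure S) (Metric.thickening δ F) + η + e k) atTop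
        (𝓝 ((ϑ : Measure S) (Metric.thickening δ F) + η + 0)) := tendsto_const_nhds.add he
    rw [add_zero] at hlim
    rw [← hlim.limsup_eq]
    refine limsup_le_limsup (Eventually.of_forall fun k => (hρ k F hF).trans ?_)
    change _ ≤ (ϑ : Measure S) (Metric.thickening δ F) + η + e k
    gcongr
    exact hϑK _ rfl
  have hth := tendsto_measure_thickening_of_isClosed (μ := (ϑ : Measure S))
    ⟨1, one_pos, measure_ne_top _ _⟩ hF
  refine ge_of_tendsto (hth.add_const _) ?_
  filter_upwards [self_mem_nhdsWithin] with δ hδ using hle δ hδ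

end Weak

/-! ### Truncated geometric bounds -/

section Dominated

variable {E : Type*} [MeasurableSpace E]

/-- The cap `N` is a dominating function, so `g` need not be integrable; this is what admits
arbitrary initial laws. -/
theorem tendsto_lintegral_min_pow_mul_add (ρ : Measure E) [IsFiniteMeasure ρ] {g : E → ℝ≥0∞}
    (hg : Measurable g) (hgt : ∀ x, g x ≠ ∞) {a : ℝ≥0∞} (ha : a < 1) (C : ℝ≥0∞) (N : ℝ≥0) :
    Tendsto (fun k : ℕ => ∫⁻ x, min (N : ℝ≥0∞) (a ^ k * g x + C) ∂ρ) atTop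
      (𝓝 (∫⁻ _, min (N : ℝ≥0∞) C ∂ρ)) := by
  refine tendsto_lintegral_of_dominated_convergence (fun _ => (N : ℝ≥0∞))
    (fun n => by fun_prop) (fun n => ae_of_all _ fun x => min_le_left _ _)
    (by simp; finiteness) (ae_of_all _ fun x => ?_)
  have h1 : Tendsto (fun k : ℕ => a ^ k * g x + C) atTop (𝓝 (0 * g x + C)) :=
    (ENNReal.Tendsto.mul_const (ENNReal.tendsto_pow_atTop_nhds_zero_of_lt_one ha)
      (Or.inr (hgt x))).add tendsto_const_nhds
  rw [zero_mul, zero_add] at h1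
  exact tendsto_const_nhds.min h1

end Dominated

/-! ### Couplings and elementary properties of the Wasserstein divergence -/

section Divergence

variable {S : Type*} [MeasurableSpace S]

theorem wassersteinDiv_le {V : S × S → ℝ≥0} {μ ν : Measure S} {ξ : Measure (S × S)}
    (hξ : ξ ∈ couplings μ ν) : wassersteinDiv V μ ν ≤ ∫⁻ p, (V p : ℝ≥0∞) ∂ξ :=
  iInf₂_le ξ hξ

theorem prod_mem_couplings (μ ν : Measure S) [IsProbabilityMeasure μ] [IsProbabilityMeasure ν] :
    μ.prod ν ∈ couplings μ ν := by
  refine ⟨inferInstance, ?_, ?_⟩ <;> simp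

theorem wassersteinDiv_dirac_le {V : S × S → ℝ≥0} (hV : Measurable V) (x y : S) :
    wassersteinDiv V (Measure.dirac x) (Measure.dirac y) ≤ V (x, y) := by
  refine (wassersteinDiv_le (prod_mem_couplings _ _)).trans_eq ?_
  rw [Measure.dirac_prod_dirac, lintegral_dirac' _ hV.coe_nnreal_ennreal]

theorem dirac_mem_finiteMoment {V : S × S → ℝ≥0} (hV : Measurable V) (x : S) :
    Measure.dirac x ∈ finiteMoment V := by
  refine ⟨inferInstance, x, ?_⟩
  rw [lintegral_dirac' _ (by fun_prop)]
  simp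

theorem wassersteinDiv_comm {V : S × S → ℝ≥0} (hV : Measurable V)
    (hsymm : ∀ x y, V (x, y) = V (y, x)) (μ ν : Measure S) :
    wassersteinDiv V μ ν = wassersteinDiv V ν μ := by
  have key (μ ν : Measure S) : wassersteinDiv V μ ν ≤ wassersteinDiv V ν μ := by
    refine le_iInf₂ fun ξ hξ => ?_
    obtain ⟨_, h1, h2⟩ := hξ
    have hmem : ξ.map Prod.swap ∈ couplings μ ν := by
      refine ⟨Measure.isProbabilityMeasure_map (by fun_prop), ?_, ?_⟩
      · rw [Measure.map_map (by fun_prop) (by fun_prop)]; exact h2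
      · rw [Measure.map_map (by fun_prop) (by fun_prop)]; exact h1
    refine (wassersteinDiv_le hmem).trans_eq ?_
    rw [lintegral_map (by fun_prop) measurable_swap]
    refine lintegral_congr fun p => ?_
    rw [Prod.swap, ← hsymm]
  exact (key μ ν).antisymm (key ν μ)

/-- The divergence to a Dirac mass is an integral, the product being the only coupling. -/
theorem wassersteinDiv_dirac_right [MeasurableSingletonClass S] {V : S × S → ℝ≥0}
    (hV : Measurable V) (μ : Measure S) [IsProbabilityMeasure μ] (y : S) :
    wassersteinDiv V μ (Measure.dirac y) = ∫⁻ x, (V (x, y) : ℝ≥0∞) ∂μ := by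
  refine le_antisymm ?_ (le_iInf₂ fun ξ hξ => ?_)
  · refine (wassersteinDiv_le (prod_mem_couplings _ _)).trans_eq ?_
    rw [Measure.prod_dirac, lintegral_map (by fun_prop) (by fun_prop)]
  · obtain ⟨_, h1, h2⟩ := hξ
    have hae : ∀ᵐ p ∂ξ, p.2 = y := by
      have : ∀ᵐ z ∂(ξ.map Prod.snd), z = y := by
        rw [h2, ae_dirac_eq]; rfl
      exact ae_of_ae_map (by fun_prop) this
    rw [← h1, lintegral_map (by fun_prop) measurable_fst]
    refine (lintegral_congr_ae ?_).le
    filter_upwards [hae] with p hp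
    rw [← hp]

/-- A Markov-type inequality for the Wasserstein divergence. -/
theorem measure_le_compl_add_wassersteinDiv_div {V : S × S → ℝ≥0} (hV : Measurable V)
    {c : ℝ≥0} (hc : 0 < c) {A B : Set S} (hA : MeasurableSet A) (hB : MeasurableSet B)
    (hAB : ∀ x ∈ A, ∀ y ∈ B, c ≤ V (x, y)) (μ ν : Measure S) :
    μ A ≤ ν Bᶜ + wassersteinDiv V μ ν / c := by
  have hc' : (c : ℝ≥0∞) ≠ 0 := by exact_mod_cast hc.ne'
  rw [← tsub_le_iff_left, ENNReal.le_div_iff_mul_le (.inl hc') (.inl ENNReal.coe_ne_top)]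
  refine le_iInf₂ fun ξ hξ => ?_
  obtain ⟨_, h1, h2⟩ := hξ
  rw [← ENNReal.le_div_iff_mul_le (.inl hc') (.inl ENNReal.coe_ne_top), tsub_le_iff_left]
  calc μ A = ξ (Prod.fst ⁻¹' A) := by rw [← h1, Measure.map_apply measurable_fst hA]
    -- Mass starting in `A` either misses `B` or pays at least `c`.
    _ ≤ ξ (Prod.snd ⁻¹' Bᶜ ∪ {p | (c : ℝ≥0∞) ≤ V p}) := by
        refine measure_mono fun p hp => ?_
        by_cases hpB : p.2 ∈ B
        · exact .inr (ENNReal.coe_le_coe.2 (hAB p.1 hp p.2 hpB))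
        · exact .inl hpB
    _ ≤ ξ (Prod.snd ⁻¹' Bᶜ) + ξ {p | (c : ℝ≥0∞) ≤ V p} := measure_union_le _ _
    _ ≤ ν Bᶜ + (∫⁻ p, (V p : ℝ≥0∞) ∂ξ) / c := by
        rw [← h2, Measure.map_apply measurable_snd hB.compl]
        gcongr
        exact meas_ge_le_lintegral_div (by fun_prop) hc' ENNReal.coe_ne_top

end Divergence

/-! ### Lower semicontinuity of the divergence, and comparison with weak closeness -/

section Polish

variable {S : Type*} [TopologicalSpace S] [PolishSpace S] [MeasurableSpace S] [BorelSpace S]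

theorem isTightMeasureSet_range_of_tendsto {μs : ℕ → ProbabilityMeasure S}
    {μ : ProbabilityMeasure S} (h : Tendsto μs atTop (𝓝 μ)) :
    IsTightMeasureSet (Set.range fun n => (μs n : Measure S)) := by
  let := TopologicalSpace.upgradeIsCompletelyMetrizable S
  have hc : IsCompact (closure (Set.range μs)) :=
    h.isCompact_insert_range.closure_of_subset (Set.subset_insert _ _)
  refine (isTightMeasureSet_of_isCompact_closure hc).subset ?_
  rintro _ ⟨n, rfl⟩
  exact ⟨μs n, ⟨n, rfl⟩, rfl⟩

/-- The Wasserstein divergence is lower semicontinuous for weak convergence. -/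
theorem wassersteinDiv_le_of_tendsto {V : S × S → ℝ≥0} (hV : LowerSemicontinuous V)
    {μs νs : ℕ → ProbabilityMeasure S} {μ ν : ProbabilityMeasure S}
    (hμ : Tendsto μs atTop (𝓝 μ)) (hν : Tendsto νs atTop (𝓝 ν)) {b : ℝ≥0∞}
    (hb : ∀ᶠ n in atTop, wassersteinDiv V (μs n : Measure S) (νs n) < b) :
    wassersteinDiv V (μ : Measure S) ν ≤ b := by
  obtain ⟨N, hN⟩ := eventually_atTop.1 hb
  have hex (n : ℕ) : ∃ ξ : ProbabilityMeasure (S × S),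
      (ξ : Measure (S × S)).map Prod.fst = μs (n + N) ∧
      (ξ : Measure (S × S)).map Prod.snd = νs (n + N) ∧
      ∫⁻ p, (V p : ℝ≥0∞) ∂(ξ : Measure (S × S)) < b := by
    obtain ⟨ξ, hξ⟩ := iInf_lt_iff.1 (hN (n + N) (Nat.le_add_left _ _))
    obtain ⟨⟨h0, h1, h2⟩, h3⟩ := iInf_lt_iff.1 hξ
    exact ⟨⟨ξ, h0⟩, h1, h2, h3⟩
  choose ξ h1 h2 h3 using hex
  have htight : IsTightMeasureSet {((m : ProbabilityMeasure (S × S)) : Measure (S × S)) |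
      m ∈ Set.range ξ} := by
    -- Tight marginals make the couplings tight; a subsequential limit then couples the limit
    -- measures.
    refine IsTightMeasureSet.prodMk ((isTightMeasureSet_range_of_tendsto hμ).subset ?_)
      ((isTightMeasureSet_range_of_tendsto hν).subset ?_)
    · rintro _ ⟨_, ⟨_, ⟨n, rfl⟩, rfl⟩, rfl⟩
      exact ⟨n + N, (h1 n).symm⟩
    · rintro _ ⟨_, ⟨_, ⟨n, rfl⟩, rfl⟩, rfl⟩
      exact ⟨n + N, (h2 n).symm⟩
  obtain ⟨η, -, φ, hφ, hlim⟩ := (isCompact_closure_of_isTightMeasureSet htight).tendsto_subseq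
    (fun n => subset_closure (Set.mem_range_self n))
  have hφN : Tendsto (fun n => φ n + N) atTop atTop :=
    (tendsto_add_atTop_nat N).comp hφ.tendsto_atTop
  have hm1 : (η : Measure (S × S)).map Prod.fst = μ := by
    have e := tendsto_nhds_unique (ProbabilityMeasure.tendsto_map_of_tendsto_of_continuous _ _ hlim
      continuous_fst) ((hμ.comp hφN).congr fun n => Subtype.ext (h1 (φ n)).symm)
    exact congrArg Subtype.val e
  have hm2 : (η : Measure (S × S)).map Prod.snd = ν := by
    have e := tendsto_nhds_unique (ProbabilityMeasure.tendsto_map_of_tendsto_of_continuous _ _ hlim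
      continuous_snd) ((hν.comp hφN).congr fun n => Subtype.ext (h2 (φ n)).symm)
    exact congrArg Subtype.val e
  refine (wassersteinDiv_le ⟨η.2, hm1, hm2⟩).trans
    ((lintegral_le_liminf_lintegral_of_lowerSemicontinuous hV fun G hG =>
      ProbabilityMeasure.le_liminf_measure_open_of_tendsto hlim hG).trans ?_)
  exact (liminf_le_liminf (Eventually.of_forall fun n => (h3 (φ n)).le)).trans_eq (by simp)

/-- Quantitative comparison of two measures through a divergence function. -/
theorem IsDivergence.exists_measure_le_thickening {S : Type*} [MetricSpace S]
    [SecondCountableTopology S] [MeasurableSpace S] [BorelSpace S] {V : S × S → ℝ≥0}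
    (hV : IsDivergence V) {K : Set S} (hK : IsCompact K) {δ : ℝ} (hδ : 0 < δ) :
    ∃ c : ℝ≥0, 0 < c ∧ ∀ μ ν : Measure S, ∀ F : Set S, IsClosed F →
      μ F ≤ ν (Metric.thickening δ F) + ν Kᶜ + wassersteinDiv V μ ν / c := by
  -- Outside `L` the cost is at least 1; on the compact set of pairs in `L ×ˢ K` at distance at
  -- least `δ`, the lower semicontinuous `V` attains a minimum, positive because the diagonal is
  -- avoided.
  obtain ⟨c, hc0, hc⟩ : ∃ c : ℝ≥0, 0 < c ∧ ∀ x y, y ∈ K → δ ≤ dist x y → c ≤ V (x, y) := by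
    obtain ⟨L, hL, hLV⟩ := hV.inf_compact 1 K hK
    let C : Set (S × S) := (L ×ˢ K) ∩ {p | δ ≤ dist p.1 p.2}
    have hC : IsCompact C := (hL.prod hK).inter_right
      (isClosed_le continuous_const (by fun_prop))
    rcases C.eq_empty_or_nonempty with hCe | hCn
    · refine ⟨1, one_pos, fun x y hy hxy => hLV x (fun hx => ?_) y hy⟩
      exact (hCe ▸ (⟨⟨hx, hy⟩, hxy⟩ : (x, y) ∈ C) : (x, y) ∈ (∅ : Set (S × S)))
    · obtain ⟨p, hp, hmin⟩ :=
        LowerSemicontinuousOn.exists_isMinOn hCn hC (hV.lowerSemicontinuous.lowerSemicontinuousOn C)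
      have hp0 : 0 < V p := by
        refine pos_iff_ne_zero.2 fun h => ?_
        have h1 : p.1 = p.2 := (hV.pos_def p.1 p.2).1 h
        have h2 : δ ≤ dist p.1 p.2 := hp.2
        rw [h1, dist_self] at h2
        exact hδ.not_ge h2
      refine ⟨min 1 (V p), lt_min one_pos hp0, fun x y hy hxy => ?_⟩
      by_cases hx : x ∈ L
      · exact (min_le_right _ _).trans (hmin ⟨⟨hx, hy⟩, hxy⟩)
      · exact (min_le_left _ _).trans (hLV x hx y hy)
  refine ⟨c, hc0, fun μ ν F hF => ?_⟩
  have hth : IsOpen (Metric.thickening δ F) := Metric.isOpen_thickening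
  refine (measure_le_compl_add_wassersteinDiv_div hV.lowerSemicontinuous.measurable hc0
    hF.measurableSet (hK.measurableSet.diff hth.measurableSet) (fun x hx y hy => ?_) μ ν).trans ?_
  · refine hc x y hy.1 (not_lt.1 fun hlt => hy.2 ?_)
    exact Metric.mem_thickening_iff.2 ⟨x, hx, by rwa [dist_comm]⟩
  · gcongr
    rw [Set.compl_sdiff]
    exact measure_union_le _ _

end Polish

/-! ### Powers of a Markov kernel -/

section Kernel

variable {S : Type*} [MeasurableSpace S]

instance isMarkovKernel_pow (Q : Kernel S S) [IsMarkovKernel Q] (k : ℕ) :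
    IsMarkovKernel (Q ^ k : Kernel S S) := by
  induction k with
  | zero => exact inferInstanceAs (IsMarkovKernel Kernel.id)
  | succ k ih => rw [pow_succ]; exact inferInstanceAs (IsMarkovKernel ((Q ^ k : Kernel S S) ∘ₖ Q))

theorem bind_pow_zero (Q : Kernel S S) (μ : Measure S) : μ.bind (Q ^ 0 : Kernel S S) = μ := by
  rw [pow_zero]; exact Measure.bind_dirac

theorem bind_pow_succ (Q : Kernel S S) (μ : Measure S) (k : ℕ) :
    μ.bind (Q ^ (k + 1) : Kernel S S) = (μ.bind (Q ^ k : Kernel S S)).bind Q := by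
  rw [pow_succ', Measure.bind_bind (Q ^ k).aemeasurable Q.aemeasurable]
  rfl

theorem bind_pow_add (Q : Kernel S S) (μ : Measure S) (m n : ℕ) :
    μ.bind (Q ^ (m + n) : Kernel S S) =
      (μ.bind (Q ^ m : Kernel S S)).bind (Q ^ n : Kernel S S) := by
  induction n with
  | zero => rw [add_zero, bind_pow_zero]
  | succ n ih => rw [← add_assoc, bind_pow_succ, ih, bind_pow_succ]

theorem bind_pow_of_bind_eq {Q : Kernel S S} {ϑ : Measure S} (h : ϑ.bind Q = ϑ) (k : ℕ) :
    ϑ.bind (Q ^ k : Kernel S S) = ϑ := by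
  induction k with
  | zero => exact bind_pow_zero Q ϑ
  | succ k ih => rw [bind_pow_succ, ih, h]

instance isProbabilityMeasure_bind (Q : Kernel S S) [IsMarkovKernel Q] (μ : Measure S)
    [IsProbabilityMeasure μ] : IsProbabilityMeasure (μ.bind Q) :=
  inferInstanceAs (IsProbabilityMeasure (Q ∘ₘ μ))

theorem bind_map_apply {E : Type*} [MeasurableSpace E] (Q : Kernel S S) (ξ : Measure E)
    {f : E → S} (hf : Measurable f) {U : Set S} (hU : MeasurableSet U) :
    ((ξ.map f).bind Q) U = ∫⁻ p, Q (f p) U ∂ξ := by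
  rw [Measure.bind_apply hU Q.aemeasurable, lintegral_map (Q.measurable_coe hU) hf]

theorem wassersteinDiv_bind_pow_le {V : S × S → ℝ≥0} {Q : Kernel S S} {a : ℝ≥0∞}
    (hc : ∀ μ ν : Measure S, wassersteinDiv V (μ.bind Q) (ν.bind Q) ≤ a * wassersteinDiv V μ ν)
    (μ ν : Measure S) (k : ℕ) :
    wassersteinDiv V (μ.bind (Q ^ k : Kernel S S)) (ν.bind (Q ^ k : Kernel S S)) ≤
      a ^ k * wassersteinDiv V μ ν := by
  induction k with
  | zero => rw [bind_pow_zero, bind_pow_zero, pow_zero, one_mul]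
  | succ k ih =>
    rw [bind_pow_succ, bind_pow_succ, pow_succ', mul_assoc]
    exact (hc _ _).trans (by gcongr)

end Kernel

/-! ### Extension of the contraction, and the invariant measure -/

section Contraction

variable {S : Type*} [TopologicalSpace S] [PolishSpace S] [MeasurableSpace S] [BorelSpace S]
  {V : S × S → ℝ≥0} {Q : Kernel S S} [IsMarkovKernel Q] {a : ℝ≥0∞}

/-- A contraction on the measures with finite moment acts on every coupling. -/
theorem wassersteinDiv_map_bind_le (hV : LowerSemicontinuous V) (ha0 : a ≠ 0) (ha : a ≠ ∞)
    (hc : ∀ μ ∈ finiteMoment V, ∀ ν ∈ finiteMoment V,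
      wassersteinDiv V (μ.bind Q) (ν.bind Q) ≤ a * wassersteinDiv V μ ν)
    (ξ : Measure (S × S)) [IsProbabilityMeasure ξ] :
    wassersteinDiv V ((ξ.map Prod.fst).bind Q) ((ξ.map Prod.snd).bind Q) ≤
      a * ∫⁻ p, (V p : ℝ≥0∞) ∂ξ := by
  by_cases htop : ∫⁻ p, (V p : ℝ≥0∞) ∂ξ = ∞
  -- This case needs `a ≠ 0`, since `0 * ∞ = 0`.
  · rw [htop, ENNReal.mul_top ha0]
    exact le_top
  have hVm := hV.measurable
  obtain ⟨𝒰, h𝒰, hopen, hliminf⟩ := exists_countable_isOpen_le_liminf (E := S)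
  have : Countable 𝒰 := h𝒰.to_subtype
  -- One sequence must serve the cost and both images under `Q`. As `Q` need not be Feller, weak
  -- convergence of the marginals would not suffice; the functions $x\mapsto Q(x,U)$ are averaged
  -- directly.
  let h : Unit ⊕ (𝒰 ⊕ 𝒰) → S × S → ℝ≥0 :=
    Sum.elim (fun _ => V) (Sum.elim (fun U p => (Q p.1 U).toNNReal)
      (fun U p => (Q p.2 U).toNNReal))
  have hm (U : 𝒰) : Measurable fun x => (Q x (U : Set S)).toNNReal :=
    (Q.measurable_coe (hopen U U.2).measurableSet).ennreal_toNNReal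
  have hle (U : 𝒰) (f : S × S → S) :
      ∫⁻ p, ((Q (f p) (U : Set S)).toNNReal : ℝ≥0∞) ∂ξ < ∞ := by
    refine (lintegral_mono (g := fun _ => 1) fun p => ?_).trans_lt (by simp)
    rw [ENNReal.coe_toNNReal (measure_ne_top _ _)]
    exact prob_le_one
  obtain ⟨x, hx⟩ := exists_tendsto_lintegral_empiricalMeasure ξ h
    (by rintro (_ | U | U)
        · exact hVm
        · exact (hm U).comp measurable_fst
        · exact (hm U).comp measurable_snd)
    (by rintro (_ | U | U)
        · exact lt_top_iff_ne_top.2 htop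
        · exact hle U Prod.fst
        · exact hle U Prod.snd)
  have : IsProbabilityMeasure (ξ.map Prod.fst) := Measure.isProbabilityMeasure_map (by fun_prop)
  have : IsProbabilityMeasure (ξ.map Prod.snd) := Measure.isProbabilityMeasure_map (by fun_prop)
  have h1 (n : ℕ) : IsProbabilityMeasure ((empiricalMeasure x n).map Prod.fst) :=
    Measure.isProbabilityMeasure_map (by fun_prop)
  have h2 (n : ℕ) : IsProbabilityMeasure ((empiricalMeasure x n).map Prod.snd) :=
    Measure.isProbabilityMeasure_map (by fun_prop)
  have hlim (f : S × S → S) (hf : Measurable f)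
      (hp : IsProbabilityMeasure (ξ.map f))
      (hpn : ∀ n, IsProbabilityMeasure ((empiricalMeasure x n).map f))
      (hlimf : ∀ U : 𝒰, Tendsto
        (fun n => ∫⁻ p, ((Q (f p) (U : Set S)).toNNReal : ℝ≥0∞) ∂(empiricalMeasure x n)) atTop
        (𝓝 (∫⁻ p, ((Q (f p) (U : Set S)).toNNReal : ℝ≥0∞) ∂ξ))) :
      Tendsto (β := ProbabilityMeasure S)
        (fun n => ⟨((empiricalMeasure x n).map f).bind Q, inferInstance⟩) atTop
        (𝓝 ⟨(ξ.map f).bind Q, inferInstance⟩) := by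
    refine tendsto_of_forall_isOpen_le_liminf' (hliminf _ _ fun U hU => ?_)
    have := hlimf ⟨U, hU⟩
    simp only [ENNReal.coe_toNNReal (measure_ne_top _ _)] at this
    change Tendsto (fun n => (((empiricalMeasure x n).map f).bind Q) U) atTop
      (𝓝 (((ξ.map f).bind Q) U))
    simpa only [bind_map_apply Q _ hf (hopen U hU).measurableSet] using this
  have hfin (n : ℕ) (f : S × S → S) (hf : Measurable f) (y : S)
      (hpn : IsProbabilityMeasure ((empiricalMeasure x n).map f)) :
      (empiricalMeasure x n).map f ∈ finiteMoment V := by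
    refine ⟨hpn, y, ?_⟩
    rw [lintegral_map (by fun_prop) hf]
    exact lintegral_empiricalMeasure_lt_top x n (h := fun p => V (f p, y)) (by fun_prop)
  refine le_of_forall_gt_imp_ge_of_dense fun b hb => ?_
  refine wassersteinDiv_le_of_tendsto hV
    (hlim Prod.fst measurable_fst inferInstance h1 fun U => hx (.inr (.inl U)))
    (hlim Prod.snd measurable_snd inferInstance h2 fun U => hx (.inr (.inr U))) ?_
  have hlt := (ENNReal.Tendsto.const_mul (hx (.inl ())) (.inr ha)).eventually_lt_const hb
  filter_upwards [hlt] with n hn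
  refine ((hc _ (hfin n _ measurable_fst (x 0).1 (h1 n)) _
    (hfin n _ measurable_snd (x 0).1 (h2 n))).trans ?_).trans_lt hn
  gcongr
  exact wassersteinDiv_le ⟨inferInstance, rfl, rfl⟩

theorem wassersteinDiv_bind_le (hV : LowerSemicontinuous V) (ha0 : a ≠ 0) (ha : a ≠ ∞)
    (hc : ∀ μ ∈ finiteMoment V, ∀ ν ∈ finiteMoment V,
      wassersteinDiv V (μ.bind Q) (ν.bind Q) ≤ a * wassersteinDiv V μ ν) (μ ν : Measure S) :
    wassersteinDiv V (μ.bind Q) (ν.bind Q) ≤ a * wassersteinDiv V μ ν := by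
  rw [wassersteinDiv.eq_def V μ ν]
  simp_rw [ENNReal.mul_iInf_of_ne ha0 ha]
  refine le_iInf₂ fun ξ hξ => ?_
  obtain ⟨_, rfl, rfl⟩ := hξ
  exact wassersteinDiv_map_bind_le hV ha0 ha hc ξ

theorem tendsto_of_wassersteinDiv_le_pow (hV : IsDivergence V) (ha : a < 1)
    {μs : ℕ → ProbabilityMeasure S} {ϑ : ProbabilityMeasure S} {c : ℝ≥0∞} (hc : c ≠ ∞)
    (h : ∀ n, wassersteinDiv V (μs n : Measure S) ϑ ≤ a ^ n * c) :
    Tendsto μs atTop (𝓝 ϑ) := by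
  let := TopologicalSpace.upgradeIsCompletelyMetrizable S
  refine tendsto_of_le_measure_thickening fun K hK δ hδ => ?_
  obtain ⟨d, hd, hle⟩ := hV.exists_measure_le_thickening hK hδ
  refine ⟨fun n => a ^ n * c / d, ?_, fun n F hF => (hle (μs n) ϑ F hF).trans ?_⟩
  · have h1 := ENNReal.Tendsto.mul_const (b := c)
      (ENNReal.tendsto_pow_atTop_nhds_zero_of_lt_one ha) (.inr hc)
    have h2 := ENNReal.Tendsto.div_const (b := (d : ℝ≥0∞)) h1 (.inr (by exact_mod_cast hd.ne'))
    simpa using h2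
  · exact add_le_add_right (ENNReal.div_le_div_right (h n) _) _

/-- Moving mass from outside a large compact set into a compact set carrying most of `μ` is
expensive, so a bounded cost leaves little mass outside. -/
theorem isTightMeasureSet_range_of_wassersteinDiv_le (hV : IsDivergence V) (μ : Measure S)
    [IsProbabilityMeasure μ] {μs : ℕ → Measure S} {c : ℝ≥0}
    (h : ∀ n, wassersteinDiv V (μs n) μ ≤ c) : IsTightMeasureSet (Set.range μs) := by
  refine isTightMeasureSet_iff_exists_isCompact_measure_compl_le.2 fun η hη => ?_
  obtain ⟨r, hr0, hr⟩ := ENNReal.lt_iff_exists_nnreal_btwn.1 hη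
  have hr0' : 0 < r := by exact_mod_cast hr0
  obtain ⟨K, hK, hμK⟩ := isTightMeasureSet_iff_exists_isCompact_measure_compl_le.1
    (isTightMeasureSet_singleton (μ := μ)) (r / 2 : ℝ≥0) (by positivity)
  -- The threshold makes the Markov term at most `r / 2`; the `+ 1` keeps it positive when `c = 0`.
  have hq : 0 < 2 * c / r + 1 := by positivity
  obtain ⟨L, hL, hLV⟩ := hV.inf_compact (2 * c / r + 1) K hK
  refine ⟨L, hL, Set.forall_mem_range.2 fun n => ?_⟩
  refine (measure_le_compl_add_wassersteinDiv_div hV.lowerSemicontinuous.measurable hq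
    hL.measurableSet.compl hK.measurableSet hLV _ μ).trans (le_trans ?_ hr.le)
  have hle : wassersteinDiv V (μs n) μ / (2 * c / r + 1 : ℝ≥0) ≤ (r / 2 : ℝ≥0) := by
    refine ENNReal.div_le_of_le_mul ((h n).trans ?_)
    rw [← ENNReal.coe_mul, ENNReal.coe_le_coe]
    have : r / 2 * (2 * c / r + 1) = c + r / 2 := by field_simp
    rw [this]
    exact le_self_add
  calc μ Kᶜ + wassersteinDiv V (μs n) μ / (2 * c / r + 1 : ℝ≥0)
      ≤ (r / 2 : ℝ≥0) + (r / 2 : ℝ≥0) := add_le_add (hμK μ rfl) hle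
    _ = r := by rw [← ENNReal.coe_add, add_halves]

/-- Compactness supplies a cluster point; the uniform bound on the tail of the orbit passes to it
and forces the whole orbit to converge there, while the shifted orbit converges to its image under
`Q`. -/
theorem exists_isProbabilityMeasure_bind_eq (hV : IsDivergence V) (ha : a < 1)
    (hc : ∀ μ ν : Measure S, wassersteinDiv V (μ.bind Q) (ν.bind Q) ≤ a * wassersteinDiv V μ ν)
    (μ : Measure S) [IsProbabilityMeasure μ] {c : ℝ≥0}
    (hμ : ∀ k : ℕ, wassersteinDiv V (μ.bind (Q ^ k : Kernel S S)) μ ≤ c) :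
    ∃ ϑ : Measure S, IsProbabilityMeasure ϑ ∧ ϑ.bind Q = ϑ := by
  have hVm := hV.lowerSemicontinuous.measurable
  let μs (n : ℕ) : ProbabilityMeasure S := ⟨μ.bind (Q ^ n : Kernel S S), inferInstance⟩
  have hpow (n k : ℕ) : wassersteinDiv V (μs (n + k) : Measure S) (μs n) ≤ a ^ n * c := by
    have h1 := wassersteinDiv_bind_pow_le hc (μ.bind (Q ^ k : Kernel S S)) μ n
    rw [← bind_pow_add, add_comm k n] at h1
    exact h1.trans (by gcongr; exact hμ k)
  have htight := (isTightMeasureSet_range_of_wassersteinDiv_le hV μ hμ).subset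
    (S := {((m : ProbabilityMeasure S) : Measure S) | m ∈ Set.range μs}) (by
      rintro _ ⟨_, ⟨n, rfl⟩, rfl⟩
      exact ⟨n, rfl⟩)
  obtain ⟨ϑ, -, φ, hφ, hlim⟩ := (isCompact_closure_of_isTightMeasureSet htight).tendsto_subseq
    (fun n => subset_closure (Set.mem_range_self n))
  have hϑ (n : ℕ) : wassersteinDiv V (ϑ : Measure S) (μs n) ≤ a ^ n * c := by
    refine le_of_forall_gt_imp_ge_of_dense fun b hb => ?_
    refine wassersteinDiv_le_of_tendsto hV.lowerSemicontinuous hlim tendsto_const_nhds ?_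
    filter_upwards [hφ.tendsto_atTop.eventually_ge_atTop n] with j hj
    obtain ⟨k, hk⟩ := Nat.exists_eq_add_of_le hj
    rw [Function.comp_apply, hk]
    exact (hpow n k).trans_lt hb
  have hconv : Tendsto μs atTop (𝓝 ϑ) := by
    refine tendsto_of_wassersteinDiv_le_pow hV ha (c := c) ENNReal.coe_ne_top fun n => ?_
    rw [wassersteinDiv_comm hVm hV.symm]
    exact hϑ n
  let ϑQ : ProbabilityMeasure S := ⟨(ϑ : Measure S).bind Q, inferInstance⟩
  have hconv' : Tendsto (fun n => μs (n + 1)) atTop (𝓝 ϑQ) := by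
    refine tendsto_of_wassersteinDiv_le_pow hV ha
      (ENNReal.mul_ne_top (ne_top_of_lt ha) ENNReal.coe_ne_top : a * c ≠ ∞) fun n => ?_
    rw [wassersteinDiv_comm hVm hV.symm]
    change wassersteinDiv V ((ϑ : Measure S).bind Q) (μ.bind (Q ^ (n + 1) : Kernel S S)) ≤ _
    rw [bind_pow_succ]
    refine (hc _ _).trans ((mul_le_mul_right (hϑ n) a).trans_eq ?_)
    ring
  have he : ϑ = ϑQ := tendsto_nhds_unique ((tendsto_add_atTop_iff_nat 1).2 hconv) hconv'
  exact ⟨ϑ, inferInstance, (congrArg Subtype.val he).symm⟩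

/-- Every initial distribution converges weakly to an invariant probability measure. -/
theorem tendsto_bind_pow (hV : IsDivergence V) (ha : a < 1)
    (hc : ∀ μ ν : Measure S, wassersteinDiv V (μ.bind Q) (ν.bind Q) ≤ a * wassersteinDiv V μ ν)
    {ϑ : Measure S} [IsProbabilityMeasure ϑ] (hϑ : ϑ.bind Q = ϑ)
    (ρ : Measure S) [IsProbabilityMeasure ρ] :
    Tendsto (β := ProbabilityMeasure S)
      (fun k : ℕ => ⟨ρ.bind (Q ^ k : Kernel S S), inferInstance⟩) atTop
      (𝓝 ⟨ϑ, inferInstance⟩) := by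
  let := TopologicalSpace.upgradeIsCompletelyMetrizable S
  have hVm := hV.lowerSemicontinuous.measurable
  refine tendsto_of_le_measure_thickening fun K hK δ hδ => ?_
  obtain ⟨d, hd, hle⟩ := hV.exists_measure_le_thickening hK hδ
  have hd' : (d : ℝ≥0∞) ≠ 0 := by exact_mod_cast hd.ne'
  -- `V` may fail to be integrable for `ρ.prod ϑ`; since probabilities are at most 1, the pointwise
  -- error can be capped. Integrating the second coordinate returns `ϑ` by invariance.
  refine ⟨fun k => ∫⁻ p, min ((1 : ℝ≥0) : ℝ≥0∞) (a ^ k * (V p / d) + 0) ∂(ρ.prod ϑ), ?_,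
    fun k F hF => ?_⟩
  · have := tendsto_lintegral_min_pow_mul_add (ρ.prod ϑ) (g := fun p => (V p : ℝ≥0∞) / d)
      (by fun_prop) (fun p => ENNReal.div_ne_top ENNReal.coe_ne_top hd') ha 0 1
    simpa using this
  · have hpt (p : S × S) : (Q ^ k : Kernel S S) p.1 F ≤
        (Q ^ k : Kernel S S) p.2 (Metric.thickening δ F) + (Q ^ k : Kernel S S) p.2 Kᶜ +
          min ((1 : ℝ≥0) : ℝ≥0∞) (a ^ k * (V p / d) + 0) := by
      rw [add_zero, ← min_add_add_left]
      refine le_min (le_add_left (by simpa using prob_le_one)) ((hle _ ((Q ^ k : Kernel S S) p.2) F hF).trans ?_)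
      gcongr
      rw [← mul_div_assoc]
      gcongr
      have h1 := wassersteinDiv_bind_pow_le hc (Measure.dirac p.1) (Measure.dirac p.2) k
      rw [Measure.dirac_bind (Q ^ k).measurable, Measure.dirac_bind (Q ^ k).measurable] at h1
      exact h1.trans (by gcongr; exact wassersteinDiv_dirac_le hVm _ _)
    have hth : MeasurableSet (Metric.thickening δ F) := Metric.isOpen_thickening.measurableSet
    have hsnd {U : Set S} (hU : MeasurableSet U) :
        ∫⁻ p, (Q ^ k : Kernel S S) p.2 U ∂(ρ.prod ϑ) = ϑ U := by
      rw [← bind_map_apply _ _ measurable_snd hU, Measure.map_snd_prod, measure_univ, one_smul,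
        bind_pow_of_bind_eq hϑ]
    have hmeas {U : Set S} (hU : MeasurableSet U) :
        Measurable fun p : S × S => (Q ^ k : Kernel S S) p.2 U :=
      ((Q ^ k).measurable_coe hU).comp measurable_snd
    have hfst : ρ.bind (Q ^ k : Kernel S S) F =
        ∫⁻ p, (Q ^ k : Kernel S S) p.1 F ∂(ρ.prod ϑ) := by
      rw [← bind_map_apply _ _ measurable_fst hF.measurableSet, Measure.map_fst_prod,
        measure_univ, one_smul]
    change ρ.bind (Q ^ k : Kernel S S) F ≤ ϑ _ + ϑ _ + _
    rw [hfst, ← hsnd hth, ← hsnd hK.measurableSet.compl, ← lintegral_add_left (hmeas hth),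
      ← lintegral_add_left (by
        exact (hmeas hth).add (hmeas hK.measurableSet.compl))]
    exact lintegral_mono hpt

end Contraction

/-! ### The law of the random iteration -/

section RandomOperators

/-- By independence the joint law of `X` and `Y` is a product, and Fubini allows freezing the state
`x`. -/
theorem map_eq_bind_of_indepFun {Ω Ω' S S' : Type*} [MeasurableSpace Ω] [MeasurableSpace Ω']
    [MeasurableSpace S] [MeasurableSpace S'] {P : Measure Ω} [IsProbabilityMeasure P]
    {X : Ω → S} {Y : Ω → Ω'} (hX : Measurable X) (hY : Measurable Y) (hXY : IndepFun X Y P)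
    {F : Ω' × S → S'} (hF : Measurable F) {Q : Kernel S S'}
    (hQ : ∀ x, P.map (fun ω => F (Y ω, x)) = Q x) :
    P.map (fun ω => F (Y ω, X ω)) = (P.map X).bind Q := by
  ext U hU
  have hFs : Measurable fun p : S × Ω' => F (p.2, p.1) := hF.comp measurable_swap
  have : IsProbabilityMeasure (P.map Y) := Measure.isProbabilityMeasure_map hY.aemeasurable
  have hcomp : P.map (fun ω => F (Y ω, X ω)) =
      (P.map fun ω => (X ω, Y ω)).map fun p : S × Ω' => F (p.2, p.1) := by
    rw [Measure.map_map hFs (hX.prodMk hY)]; rfl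
  rw [hcomp, (indepFun_iff_map_prod_eq_prod_map_map hX.aemeasurable hY.aemeasurable).1 hXY,
    Measure.map_apply hFs hU, Measure.prod_apply (hFs hU), Measure.bind_apply hU Q.aemeasurable]
  refine lintegral_congr fun x => ?_
  rw [← hQ x, Measure.map_apply (f := fun ω => F (Y ω, x)) (hF.comp (hY.prodMk measurable_const)) hU,
    Measure.map_apply hY (measurable_prodMk_left (hFs hU))]
  rfl

variable {Ω S : Type*} [mΩ : MeasurableSpace Ω] [mS : MeasurableSpace S] {P : Measure Ω}
  [IsProbabilityMeasure P] {T : ℕ → Ω → S → S} {s : ℕ → Ω → S} {Q : Kernel S S}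

theorem IsRandomOperatorIteration.measurable_and_map_eq (hs : IsRandomOperatorIteration P T s Q)
    (k : ℕ) : Measurable (s k) ∧ P.map (s k) = (P.map (s 0)).bind (Q ^ k : Kernel S S) := by
  obtain ⟨𝒢, hle, hind, h0, hT⟩ := hs.independent
  have hstep (k : ℕ) : s (k + 1) = (fun p : Ω × S => T k p.1 p.2) ∘ fun ω => (ω, s k ω) :=
    funext (hs.iterate k)
  have hmeas (k : ℕ) : Measurable[⨆ i ∈ Set.Iic k, 𝒢 i] (s k) := by
    induction k with
    | zero => exact h0.mono (le_iSup₂_of_le 0 (Set.mem_Iic.2 le_rfl) le_rfl) le_rfl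
    | succ k ih =>
      rw [hstep]
      refine (hT k).comp (Measurable.prodMk ?_ ?_)
      · exact measurable_id'' (le_iSup₂_of_le (k + 1) (Set.mem_Iic.2 le_rfl) le_rfl)
      · exact ih.mono (biSup_mono fun i hi => Set.mem_Iic.2 ((Set.mem_Iic.1 hi).trans k.le_succ))
          le_rfl
  have hsle (k : ℕ) : (⨆ i ∈ Set.Iic k, 𝒢 i) ≤ mΩ := iSup₂_le fun i _ => hle i
  refine ⟨(hmeas k).mono (hsle k) le_rfl, ?_⟩
  induction k with
  | zero => rw [bind_pow_zero]
  | succ k ih =>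
    -- The noise variable is the identity of `Ω`, with target σ-algebra `𝒢 (k + 1)`; the state `s k`
    -- depends only on `𝒢 0, …, 𝒢 k`.
    have hXY : @IndepFun Ω S Ω mΩ mS (𝒢 (k + 1)) (s k) id P := by
      have h := indep_iSup_of_disjoint hle hind (S := Set.Iic k) (T := {k + 1})
        (Set.disjoint_singleton_right.2 (by simp))
      rw [iSup_singleton] at h
      refine (@IndepFun_iff_Indep _ _ _ _ _ (𝒢 (k + 1)) _ _ _).2 ?_
      rw [MeasurableSpace.comap_id]
      exact indep_of_indep_of_le_left h (hmeas k).comap_le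
    rw [bind_pow_succ, ← ih, hstep]
    exact @map_eq_bind_of_indepFun Ω Ω S S mΩ (𝒢 (k + 1)) mS mS P _ (s k) id
      ((hmeas k).mono (hsle k) le_rfl) (measurable_id'' (hle (k + 1))) hXY _ (hT k) Q
      (hs.transition k)

end RandomOperators

/-! ### Consequences of the drift inequality -/

section Drift

variable {S : Type*} [MeasurableSpace S] {Q : Kernel S S} [IsMarkovKernel Q] {g : S → ℝ≥0∞}
  {a e C : ℝ≥0∞}

/-- The condition on `C` makes the bound stable under one more step; `C` plays the role of
$\epsilon/(1-\alpha)$. -/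
theorem lintegral_pow_le_of_drift (hg : Measurable g)
    (h : ∀ x, ∫⁻ y, g y ∂(Q x) ≤ a * g x + e) (hC : a * C + e ≤ C) (k : ℕ) (x : S) :
    ∫⁻ y, g y ∂((Q ^ k : Kernel S S) x) ≤ a ^ k * g x + C := by
  have hQ (k : ℕ) : (Q ^ k : Kernel S S) x = (Measure.dirac x).bind (Q ^ k : Kernel S S) :=
    (Measure.dirac_bind (Q ^ k).measurable x).symm
  induction k with
  | zero =>
    rw [hQ, bind_pow_zero, lintegral_dirac' _ hg, pow_zero, one_mul]
    exact le_self_add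
  | succ k ih =>
    rw [hQ, bind_pow_succ, ← hQ, Measure.lintegral_bind Q.aemeasurable hg.aemeasurable]
    calc ∫⁻ y, ∫⁻ z, g z ∂(Q y) ∂((Q ^ k : Kernel S S) x)
        ≤ ∫⁻ y, (a * g y + e) ∂((Q ^ k : Kernel S S) x) := lintegral_mono h
      _ = a * ∫⁻ y, g y ∂((Q ^ k : Kernel S S) x) + e := by
          rw [lintegral_add_right _ measurable_const, lintegral_const_mul _ hg]
          simp
      _ ≤ a * (a ^ k * g x + C) + e := by gcongr
      _ = a ^ (k + 1) * g x + (a * C + e) := by ring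
      _ ≤ a ^ (k + 1) * g x + C := by gcongr

theorem lintegral_min_bind_pow_le (hg : Measurable g)
    (h : ∀ x, ∫⁻ y, g y ∂(Q x) ≤ a * g x + e) (hC : a * C + e ≤ C) (ρ : Measure S) (N : ℝ≥0)
    (k : ℕ) : ∫⁻ x, min (N : ℝ≥0∞) (g x) ∂(ρ.bind (Q ^ k : Kernel S S)) ≤
      ∫⁻ x, min (N : ℝ≥0∞) (a ^ k * g x + C) ∂ρ := by
  rw [Measure.lintegral_bind (Q ^ k).aemeasurable (by fun_prop)]
  refine lintegral_mono fun x => le_min ?_ ?_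
  · exact (lintegral_mono fun y => min_le_left _ _).trans_eq (by simp)
  · exact (lintegral_mono fun y => min_le_right _ _).trans (lintegral_pow_le_of_drift hg h hC k x)

theorem lintegral_le_of_drift_of_bind_eq (hg : Measurable g) (hgt : ∀ x, g x ≠ ∞) (ha : a < 1)
    (h : ∀ x, ∫⁻ y, g y ∂(Q x) ≤ a * g x + e) (hC : a * C + e ≤ C) {ϑ : Measure S}
    [IsProbabilityMeasure ϑ] (hϑ : ϑ.bind Q = ϑ) : ∫⁻ x, g x ∂ϑ ≤ C := by
  have hN (N : ℕ) : ∫⁻ x, min ((N : ℝ≥0) : ℝ≥0∞) (g x) ∂ϑ ≤ C := by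
    -- By invariance the left side does not depend on `k`, so `k → ∞` removes the term in `g` before
    -- its integrability is known; the cap `N` is then raised by monotone convergence.
    refine (ge_of_tendsto' (tendsto_lintegral_min_pow_mul_add ϑ hg hgt ha C N) fun k => ?_).trans
      ((lintegral_mono fun _ => min_le_right _ _).trans_eq (by simp))
    have := lintegral_min_bind_pow_le hg h hC ϑ N k
    rwa [bind_pow_of_bind_eq hϑ] at this
  have hsup : ∫⁻ x, g x ∂ϑ = ⨆ N : ℕ, ∫⁻ x, min ((N : ℝ≥0) : ℝ≥0∞) (g x) ∂ϑ := by
    rw [← lintegral_iSup (f := fun (N : ℕ) x => min ((N : ℝ≥0) : ℝ≥0∞) (g x)) (fun N => by fun_prop)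
      (fun m n hmn x => min_le_min_right _ (ENNReal.coe_le_coe.2 (Nat.cast_le.2 hmn)))]
    refine lintegral_congr fun x => le_antisymm ?_ (iSup_le fun N => min_le_right _ _)
    obtain ⟨N, hN⟩ := ENNReal.exists_nat_gt (hgt x)
    exact le_iSup_of_le N (le_min (by exact_mod_cast hN.le) le_rfl)
  rw [hsup]
  exact iSup_le hN

theorem limsup_measure_ge_le_of_drift (hg : Measurable g) (hgt : ∀ x, g x ≠ ∞) (ha : a < 1)
    (h : ∀ x, ∫⁻ y, g y ∂(Q x) ≤ a * g x + e) (hC : a * C + e ≤ C) (ρ : Measure S)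
    [IsProbabilityMeasure ρ] {κ : ℝ≥0} (hκ : κ ≠ 0) :
    limsup (fun k : ℕ => ρ.bind (Q ^ k : Kernel S S) {x | (κ : ℝ≥0∞) ≤ g x}) atTop ≤ C / κ := by
  have hκ' : (κ : ℝ≥0∞) ≠ 0 := by exact_mod_cast hκ
  have hlim := ENNReal.Tendsto.div_const (b := (κ : ℝ≥0∞))
    (tendsto_lintegral_min_pow_mul_add ρ hg hgt ha C κ) (.inr hκ')
  calc limsup (fun k : ℕ => ρ.bind (Q ^ k : Kernel S S) {x | (κ : ℝ≥0∞) ≤ g x}) atTop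
      ≤ limsup (fun k : ℕ => (∫⁻ x, min (κ : ℝ≥0∞) (a ^ k * g x + C) ∂ρ) / κ) atTop := by
        refine limsup_le_limsup (Eventually.of_forall fun k => ?_)
        refine le_trans ?_ (ENNReal.div_le_div_right (lintegral_min_bind_pow_le hg h hC ρ κ k) _)
        -- Truncation at `κ` itself leaves the event unchanged, so Markov's inequality needs no
        -- moment of the initial law.
        refine (measure_mono (t := {x | (κ : ℝ≥0∞) ≤ min (κ : ℝ≥0∞) (g x)}) fun x hx => ?_).trans
          (meas_ge_le_lintegral_div (by fun_prop) hκ' ENNReal.coe_ne_top)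
        exact le_min (le_refl (κ : ℝ≥0∞)) hx
    _ = (∫⁻ _, min (κ : ℝ≥0∞) C ∂ρ) / κ := hlim.limsup_eq
    _ ≤ C / κ := by
        gcongr
        simp

end Drift

end WassersteinDivergence

/-! ### Proof of the theorem -/

open WassersteinDivergence in
theorem theorem4
    {Ω S : Type*} [MeasurableSpace Ω] [TopologicalSpace S] [PolishSpace S]
    [MeasurableSpace S] [BorelSpace S]
    (P : Measure Ω) [IsProbabilityMeasure P]
    (T : ℕ → Ω → S → S) (s : ℕ → Ω → S)
    (Q : Kernel S S) [IsMarkovKernel Q]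
    (hs : IsRandomOperatorIteration P T s Q)
    (V' : S × S → ℝ≥0) (hV' : ContractionAssumption V' Q)
    (V : S × S → ℝ≥0) (hV : LowerSemicontinuous V)
    (sstar : S) (α ε : ℝ) (hα0 : 0 < α) (hα1 : α < 1) (hε : 0 < ε)
    (hdrift : ∀ μ ∈ finiteMoment V,
      wassersteinDiv V (μ.bind Q) (Measure.dirac sstar) ≤
        ENNReal.ofReal α * wassersteinDiv V μ (Measure.dirac sstar) + ENNReal.ofReal ε) :
    ∃ ϑ : Measure S, IsProbabilityMeasure ϑ ∧ ϑ.bind Q = ϑ ∧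
      (∀ ν : Measure S, IsProbabilityMeasure ν → ν.bind Q = ν → ν = ϑ) ∧
      wassersteinDiv V ϑ (Measure.dirac sstar) ≤ ENNReal.ofReal (ε / (1 - α)) ∧
      ∀ κ : ℝ, 0 < κ →
        limsup (fun k : ℕ => P {ω | κ ≤ (V (s k ω, sstar) : ℝ)}) atTop ≤
          ENNReal.ofReal (ε / (κ * (1 - α))) ∧
        (ϑ (frontier {x : S | κ ≤ (V (x, sstar) : ℝ)}) = 0 →
          Tendsto (fun k : ℕ => P {ω | κ ≤ (V (s k ω, sstar) : ℝ)}) atTop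
            (𝓝 (ϑ {x : S | κ ≤ (V (x, sstar) : ℝ)}))) := by
  have hVm := hV.measurable
  have hdiv := hV'.isDivergence
  obtain ⟨α', hα'0, hα'1, hcontr⟩ := hV'.contraction
  have ha' : ENNReal.ofReal α' < 1 := ENNReal.ofReal_lt_one.2 hα'1
  have hc := wassersteinDiv_bind_le hdiv.lowerSemicontinuous (ENNReal.ofReal_pos.2 hα'0).ne'
    ENNReal.ofReal_ne_top hcontr
  obtain ⟨M, ⟨μ, hμM⟩, hMsub, hM⟩ := hV'.bounded
  obtain ⟨c, hμc⟩ := hM μ hμM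
  have := (hMsub hμM).1
  obtain ⟨ϑ, _, hϑ⟩ := exists_isProbabilityMeasure_bind_eq hdiv ha' hc μ (iSup_le_iff.1 hμc)
  have hconv (ρ : Measure S) [IsProbabilityMeasure ρ] := tendsto_bind_pow hdiv ha' hc hϑ ρ
  let g : S → ℝ≥0∞ := fun x => V (x, sstar)
  have hg : Measurable g := by fun_prop
  have hgt (x : S) : g x ≠ ∞ := ENNReal.coe_ne_top
  have hQg (x : S) : ∫⁻ y, g y ∂(Q x) ≤ ENNReal.ofReal α * g x + ENNReal.ofReal ε := by
    -- Between Dirac masses the divergence is the cost itself, so the assumption becomes a pointwise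
    -- drift inequality.
    have h := hdrift _ (dirac_mem_finiteMoment hVm x)
    rwa [Measure.dirac_bind Q.measurable, wassersteinDiv_dirac_right hVm,
      wassersteinDiv_dirac_right hVm, lintegral_dirac' _ hg] at h
  have ha : ENNReal.ofReal α < 1 := ENNReal.ofReal_lt_one.2 hα1
  have h1α : 0 < 1 - α := sub_pos.2 hα1
  have hC : ENNReal.ofReal α * ENNReal.ofReal (ε / (1 - α)) + ENNReal.ofReal ε ≤
      ENNReal.ofReal (ε / (1 - α)) := by
    rw [← ENNReal.ofReal_mul hα0.le, ← ENNReal.ofReal_add (by positivity) hε.le]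
    refine ENNReal.ofReal_le_ofReal (le_of_eq ?_)
    field_simp
    ring
  refine ⟨ϑ, inferInstance, hϑ, fun ν _ hν => ?_, ?_, fun κ hκ => ?_⟩
  · have h := hconv ν
    simp only [bind_pow_of_bind_eq hν] at h
    let ν' : ProbabilityMeasure S := ⟨ν, inferInstance⟩
    let ϑ' : ProbabilityMeasure S := ⟨ϑ, inferInstance⟩
    have he : ν' = ϑ' := tendsto_nhds_unique tendsto_const_nhds h
    exact congrArg Subtype.val he
  · rw [wassersteinDiv_dirac_right hVm]
    exact lintegral_le_of_drift_of_bind_eq hg hgt ha hQg hC hϑ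
  have : IsProbabilityMeasure (P.map (s 0)) :=
    Measure.isProbabilityMeasure_map (hs.measurable_and_map_eq 0).1.aemeasurable
  have hA : MeasurableSet {x : S | κ ≤ (V (x, sstar) : ℝ)} :=
    measurableSet_le measurable_const (by fun_prop)
  have hlaw (k : ℕ) : P {ω | κ ≤ (V (s k ω, sstar) : ℝ)} =
      (P.map (s 0)).bind (Q ^ k : Kernel S S) {x : S | κ ≤ (V (x, sstar) : ℝ)} := by
    obtain ⟨hm, hmap⟩ := hs.measurable_and_map_eq k
    rw [← hmap, Measure.map_apply hm hA]
    rfl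
  simp_rw [hlaw]
  refine ⟨?_, fun hfr => ?_⟩
  · lift κ to ℝ≥0 using hκ.le
    have hκ0 : κ ≠ 0 := by rintro rfl; simp at hκ
    have h := limsup_measure_ge_le_of_drift hg hgt ha hQg hC (P.map (s 0)) hκ0
    simp only [g, ENNReal.coe_le_coe] at h
    rw [mul_comm (κ : ℝ), ← div_div, ENNReal.ofReal_div_of_pos hκ, ENNReal.ofReal_coe_nnreal]
    exact_mod_cast h
  · exact ProbabilityMeasure.tendsto_measure_of_null_frontier_of_tendsto' (hconv (P.map (s 0))) hfr
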